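/- Fix a physical dimension $d$. A tensor $A$ of bond dimension $D$ is a family $(A^i)_{i=1}^d$ of complex $D\times D$ matrices; the matrix product vector (MPV) it generates on $N\ge 1$ sites is $$|V^{(N)}(A)\rangle=\sum_{i_1,\dots,i_N=1}^d \mathrm{tr}(A^{i_1}\cdots A^{i_N})\,|i_1\cdots i_N\rangle\in(\mathbb C^d)^{\otimes N},$$ and its transfer operator is $\mathcal E_A(X)=\sum_{i=1}^d A^iX(A^i)^\dagger$. The tensor $A$ is called normal if $1$ is a nondegenerate eigenvalue of $\mathcal E_A$, all other eigenvalues of $\mathcal E_A$ have modulus $<1$, and $\mathcal E_A$ and its Hilbert–Schmidt adjoint each have a positive definite fixed point. The tensor $A$ is in canonical form if, in some orthonormal basis of $\mathbb C^D$, $A^i=\bigoplus_{k=1}^r\mu_kA^i_k$ for all $i$, with numbers $\mu_k>0$ and normal tensors $A_k$; it is in canonical form in the unital gauge if the $A_k$ can moreover be chosen with $\mathcal E_{A_k}(\mathbb 1)=\mathbb 1$ for all $k$. **Corollary 2 (Fundamental Theorem for equal MPVs).** Let $A$ and $B$ be tensors in canonical form, with the same physical dimension and bond dimensions $D$ and $D'$,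 such that $|V^{(N)}(A)\rangle=|V^{(N)}(B)\rangle$ for all $N\ge1$. Then (i) $D=D'$; (ii) there exists an invertible matrix $X$ such that $A^i=XB^iX^{-1}$ for all $i$. If moreover both $A$ and $B$ are in canonical form in the unital gauge, then $X$ in (ii) can be taken to be unitary. -/

import Mathlib

open scoped Matrix ComplexOrder

noncomputable section

/-- A translationally invariant tensor with physical dimension `d` and bond dimension `D`:
one complex `D × D` matrix `A i` for each physical index `i`. -/
abbrev MPVTensor (d D : ℕ) : Type := Fin d → Matrix (Fin D) (Fin D) ℂ

/-- The matrix product vector on `N` sites generated by `A`, given by its coefficients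
`tr (A (s 0) * ⋯ * A (s (N - 1)))` in the product basis of `(ℂ^d)^{⊗ N}`, whose elements are
indexed by the words `s` of length `N`. -/
def mpv {d D : ℕ} (A : MPVTensor d D) (N : ℕ) : (Fin N → Fin d) → ℂ :=
  fun s => Matrix.trace (List.ofFn fun n => A (s n)).prod

/-- The transfer operator `X ↦ ∑ i, A i * X * (A i)ᴴ`. -/
def transferMap {d D : ℕ} (A : MPVTensor d D) :
    Module.End ℂ (Matrix (Fin D) (Fin D) ℂ) where
  toFun X := ∑ i, A i * X * (A i)ᴴ
  map_add' X Y := by simp [Matrix.mul_add, Matrix.add_mul, Finset.sum_add_distrib]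
  map_smul' c X := by simp [Finset.smul_sum]

/-- Spectral condition for primitivity of a completely positive map `E` on matrices: `1` is a
nondegenerate eigenvalue, all other eigenvalues have modulus less than one, and the right and
left eigenvectors of the eigenvalue `1` can be taken positive and of full rank. -/
structure IsPrimitiveMap {D : ℕ} (E : Module.End ℂ (Matrix (Fin D) (Fin D) ℂ)) : Prop where
  simple : Module.finrank ℂ (Module.End.eigenspace E 1) = 1
  norm_lt_one : ∀ z : ℂ, E.HasEigenvalue z → z ≠ 1 → ‖z‖ < 1
  right_eigenvector : ∃ ρ : Matrix (Fin D) (Fin D) ℂ, ρ.PosDef ∧ E ρ = ρ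
  /-- `σ` is a fixed point of the adjoint of `E` for the Hilbert-Schmidt inner product. -/
  left_eigenvector : ∃ σ : Matrix (Fin D) (Fin D) ℂ, σ.PosDef ∧
    ∀ X : Matrix (Fin D) (Fin D) ℂ, (σ * E X).trace = (σ * X).trace

/-- A tensor is normal if its transfer operator is primitive. -/
def IsNormalTensor {d D : ℕ} (A : MPVTensor d D) : Prop :=
  IsPrimitiveMap (transferMap A)

/-- A presentation of `A` in canonical form, `A i = ⨁ k, μ k • block k i`, with `μ k > 0` and
normal blocks. The direct sum is one of mutually orthogonal subspaces of `ℂ^D`: the columns of the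
unitary `U` are an orthonormal basis of `ℂ^D` adapted to it (a permutation matrix when the
matrices are block diagonal in the standard basis). -/
structure CanonicalForm {d D : ℕ} (A : MPVTensor d D) where
  r : ℕ
  dim : Fin r → ℕ
  μ : Fin r → ℝ
  block : (k : Fin r) → MPVTensor d (dim k)
  U : Matrix (Fin D) ((k : Fin r) × Fin (dim k)) ℂ
  μ_pos : ∀ k, 0 < μ k
  normal : ∀ k, IsNormalTensor (block k)
  U_mul_conjTranspose : U * Uᴴ = 1
  conjTranspose_mul_U : Uᴴ * U = 1
  eq_directSum : ∀ i,
    A i = U * Matrix.blockDiagonal' (fun k => (μ k : ℂ) • block k i) * Uᴴ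

/-- `A` is in canonical form. -/
def IsCanonical {d D : ℕ} (A : MPVTensor d D) : Prop := Nonempty (CanonicalForm A)

/-- `A` is in canonical form in the unital gauge: the transfer operators of its normal blocks
are unital. -/
def IsUnitalCanonical {d D : ℕ} (A : MPVTensor d D) : Prop :=
  ∃ c : CanonicalForm A, ∀ k, transferMap (c.block k) 1 = 1

end

/-!
A tensor `A` is a finite-dimensional module over the free algebra on the letters `Fin d`, and
`tr (A (s 0) * ⋯ * A (s (N - 1)))` is the value of its character on a word. The theorem is that a
semisimple module is determined by its character; no limit `N → ∞` is needed.

A normal tensor has no proper invariant subspace `W`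
(`IsNormalTensor.eq_bot_or_eq_top`): the transfer operator would have a fixed point with range in
`W`, against the nondegeneracy of the eigenvalue `1` with its full-rank eigenvector. So the summands
`μ k • block k` of a canonical form are simple modules. By the Jacobson density theorem some
polynomial in the letters acts as the identity on the summands isomorphic to a given one and as zero
on all others (`exists_smul_eq_ite_of_isSimpleModule`). Its traces on `A` and `B` count how often
the given summand occurs in each, so the summands of `A` and `B` are matched by a bijection up to
gauge (`exists_equiv_of_trace_eq`). As only words of positive length are given, the polynomial must
have no constant term; this is achieved by letting it also vanish on the one-dimensional module on
which all letters act as zero, which is not isomorphic to any summand.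

In the unital gauge let `Y` be an invertible intertwiner of two matched summands with weights `μ`
and `ν`. Then `Y * Yᴴ` is an eigenvector of the transfer operator for the eigenvalue `(ν / μ) ^ 2`,
so that `ν ≤ μ` and by symmetry `μ = ν`; now `Y * Yᴴ` and `1` are both fixed points, and `Y` is a
multiple of a unitary matrix (`IsNormalTensor.exists_unitary_intertwiner`).
-/

noncomputable section

variable {d : ℕ}

/-! ### Modules over the algebra of words -/

/-- Evaluation of noncommutative polynomials in the letters `Fin d` at the matrices of `A`. -/
def wordEval {D : ℕ} (A : MPVTensor d D) :
    FreeAlgebra ℂ (Fin d) →ₐ[ℂ] Matrix (Fin D) (Fin D) ℂ :=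
  FreeAlgebra.lift ℂ A

@[simp]
theorem wordEval_ι {D : ℕ} (A : MPVTensor d D) (i : Fin d) :
    wordEval A (FreeAlgebra.ι ℂ i) = A i := by
  simp [wordEval]

/-- The space `ℂ^D` as a module over the free algebra, each letter `i` acting as `A i`. A type
synonym, so that different tensors of the same bond dimension give different modules. -/
def WordModule {D : ℕ} (_A : MPVTensor d D) : Type := Fin D → ℂ

namespace WordModule

variable {D : ℕ} (A : MPVTensor d D)

instance : AddCommGroup (WordModule A) := inferInstanceAs (AddCommGroup (Fin D → ℂ))

instance : Module ℂ (WordModule A) := inferInstanceAs (Module ℂ (Fin D → ℂ))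

instance : FiniteDimensional ℂ (WordModule A) :=
  inferInstanceAs (FiniteDimensional ℂ (Fin D → ℂ))

/-- The identity map from `ℂ^D` to the module. -/
def of : (Fin D → ℂ) ≃ₗ[ℂ] WordModule A := LinearEquiv.refl ℂ _

instance : SMul (FreeAlgebra ℂ (Fin d)) (WordModule A) where
  smul p v := of A (wordEval A p *ᵥ (of A).symm v)

theorem smul_def (p : FreeAlgebra ℂ (Fin d)) (v : WordModule A) :
    p • v = of A (wordEval A p *ᵥ (of A).symm v) := rfl

instance : Module (FreeAlgebra ℂ (Fin d)) (WordModule A) where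
  one_smul v := by simp [smul_def]
  mul_smul p q v := by simp [smul_def]
  smul_zero p := by simp [smul_def]
  smul_add p v w := by simp [smul_def, Matrix.mulVec_add]
  add_smul p q v := by simp [smul_def, Matrix.add_mulVec]
  zero_smul v := by simp [smul_def]

instance : IsScalarTower ℂ (FreeAlgebra ℂ (Fin d)) (WordModule A) where
  smul_assoc c p v := by simp [smul_def, Matrix.smul_mulVec]

variable {A}

/-- Isomorphic modules come from gauge equivalent tensors. -/
theorem exists_intertwiner {D' : ℕ} {B : MPVTensor d D'}
    (e : WordModule A ≃ₗ[FreeAlgebra ℂ (Fin d)] WordModule B) :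
    ∃ (Y : Matrix (Fin D) (Fin D') ℂ) (Z : Matrix (Fin D') (Fin D) ℂ),
      Y * Z = 1 ∧ Z * Y = 1 ∧ ∀ i, A i * Y = Y * B i := by
  let u : (Fin D → ℂ) ≃ₗ[ℂ] (Fin D' → ℂ) :=
    (of A).trans ((e.restrictScalars ℂ).trans (of B).symm)
  refine ⟨LinearMap.toMatrix' u.symm, LinearMap.toMatrix' u, ?_, ?_, fun i => ?_⟩
  · rw [← LinearMap.toMatrix'_comp, ← LinearMap.toMatrix'_id]
    simp
  · rw [← LinearMap.toMatrix'_comp, ← LinearMap.toMatrix'_id]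
    simp
  · apply Matrix.toLin'.injective
    refine LinearMap.ext fun v => ?_
    have h := e.symm.map_smul (FreeAlgebra.ι ℂ i) (of B v)
    rw [smul_def, smul_def, wordEval_ι, wordEval_ι, LinearEquiv.symm_apply_apply] at h
    rw [Matrix.toLin'_mul, Matrix.toLin'_mul, Matrix.toLin'_toMatrix']
    exact ((of A).symm_apply_eq.2 h).symm

theorem dim_eq {D' : ℕ} {B : MPVTensor d D'}
    (e : WordModule A ≃ₗ[FreeAlgebra ℂ (Fin d)] WordModule B) : D = D' := by
  obtain ⟨Y, Z, hYZ, hZY, -⟩ := exists_intertwiner e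
  simpa using Matrix.square_of_invertible Y Z hYZ hZY

/-- A tensor of positive bond dimension without proper invariant subspaces gives a simple
module. -/
theorem isSimpleModule (hD : 0 < D)
    (h : ∀ W : Submodule ℂ (Fin D → ℂ), (∀ i, ∀ v ∈ W, A i *ᵥ v ∈ W) → W = ⊥ ∨ W = ⊤) :
    IsSimpleModule (FreeAlgebra ℂ (Fin d)) (WordModule A) := by
  have : Nonempty (Fin D) := ⟨⟨0, hD⟩⟩
  have : Nontrivial (WordModule A) := inferInstanceAs (Nontrivial (Fin D → ℂ))
  refine { eq_bot_or_eq_top := fun W => ?_ }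
  let W' : Submodule ℂ (Fin D → ℂ) := (W.restrictScalars ℂ).comap (of A).toLinearMap
  have hmem : ∀ v, v ∈ W ↔ (of A).symm v ∈ W' := fun v => by simp [W']
  have hW : W' = ⊥ ∨ W' = ⊤ := h W' fun i v hv => by
    have := W.smul_mem (FreeAlgebra.ι ℂ i) ((hmem (of A v)).2 (by simpa using hv))
    rwa [smul_def, wordEval_ι, hmem, LinearEquiv.symm_apply_apply,
      LinearEquiv.symm_apply_apply] at this
  refine hW.imp (fun h0 => ?_) (fun h1 => ?_)
  · refine (Submodule.eq_bot_iff _).2 fun v hv => ?_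
    rwa [hmem, h0, Submodule.mem_bot, LinearEquiv.map_eq_zero_iff] at hv
  · exact Submodule.eq_top_iff'.2 fun v => by rw [hmem, h1]; exact Submodule.mem_top

end WordModule

/-! ### Separating isomorphism classes of simple modules -/

/-- By the Jacobson density theorem, some element of `R` acts on a finite family of simple modules
as the projection onto the isotypic component of a given one. -/
theorem exists_smul_eq_ite_of_isSimpleModule (F : Type*) {R J : Type*} [Field F] [Ring R]
    [Algebra F R] [Finite J] (M : J → Type*) [∀ j, AddCommGroup (M j)] [∀ j, Module F (M j)]
    [∀ j, FiniteDimensional F (M j)] [∀ j, Module R (M j)] [∀ j, IsScalarTower F R (M j)]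
    [∀ j, IsSimpleModule R (M j)] (k : J) :
    ∃ r : R, ∀ j, (Nonempty (M j ≃ₗ[R] M k) → ∀ x : M j, r • x = x) ∧
      (¬ Nonempty (M j ≃ₗ[R] M k) → ∀ x : M j, r • x = 0) := by
  classical
  have := Fintype.ofFinite J
  let c : J → Prop := fun j => Nonempty (M j ≃ₗ[R] M k)
  -- Schur's lemma: the projection commutes with all endomorphisms of the product module.
  let f : Module.End (Module.End R (∀ j, M j)) (∀ j, M j) :=
    { toFun := fun x j => if c j then x j else 0
      map_add' := fun x y => by
        ext j; by_cases h : c j <;> simp [h]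
      map_smul' := fun g x => by
        ext j
        have key : ∀ i, (if c j then g (Pi.single i (x i)) j else 0) =
            g (Pi.single i (if c i then x i else 0)) j := by
          intro i
          let gij : M i →ₗ[R] M j := LinearMap.proj j ∘ₗ g ∘ₗ LinearMap.single R M i
          rcases gij.bijective_or_eq_zero with hb | h0
          · have e := LinearEquiv.ofBijective gij hb
            have hc : c i ↔ c j :=
              ⟨fun ⟨u⟩ => ⟨e.symm.trans u⟩, fun ⟨u⟩ => ⟨e.trans u⟩⟩
            by_cases h : c j
            · simp [h, hc.2 h]
            · simp [h, mt hc.1 h]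
          · have hz : ∀ y, g (Pi.single i y) j = 0 := fun y => LinearMap.congr_fun h0 y
            simp [hz]
        have hx : ∀ y : (∀ j, M j), g y j = ∑ i, g (Pi.single i (y i)) j := fun y => by
          conv_lhs => rw [← Finset.univ_sum_single y]
          rw [map_sum, Finset.sum_apply]
        simp only [Module.End.smul_def, RingHom.id_apply]
        rw [hx, hx (fun j => if c j then x j else 0), ← Finset.sum_congr rfl fun i _ => key i]
        split_ifs <;> simp }
  obtain ⟨s, hs⟩ := Module.Finite.fg_top (R := F) (M := ∀ j, M j)
  obtain ⟨r, hr⟩ := jacobson_density f s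
  have hall : ∀ x : (∀ j, M j), f x = r • x := by
    intro x
    have hx : x ∈ Submodule.span F (s : Set (∀ j, M j)) := hs ▸ Submodule.mem_top
    induction hx using Submodule.span_induction with
    | mem x hx => exact hr x hx
    | zero => simp
    | add x y _ _ hx hy => rw [map_add, smul_add, hx, hy]
    | smul a x _ hx =>
      rw [smul_comm, ← hx]
      ext j
      by_cases h : c j <;> simp [f, h]
  refine ⟨r, fun j => ⟨fun h x => ?_, fun h x => ?_⟩⟩
  · simpa [f, show c j from h] using (congrFun (hall (Pi.single j x)) j).symm
  · simpa [f, show ¬ c j from h] using (congrFun (hall (Pi.single j x)) j).symm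

open Classical in
theorem exists_wordEval_eq_ite {J : Type*} [Finite J] (dim : J → ℕ)
    (t : ∀ j, MPVTensor d (dim j))
    [∀ j, IsSimpleModule (FreeAlgebra ℂ (Fin d)) (WordModule (t j))] (k : J) :
    ∃ p : FreeAlgebra ℂ (Fin d), ∀ j, wordEval (t j) p =
      if Nonempty (WordModule (t j) ≃ₗ[FreeAlgebra ℂ (Fin d)] WordModule (t k)) then 1 else 0 := by
  obtain ⟨p, hp⟩ := exists_smul_eq_ite_of_isSimpleModule ℂ (R := FreeAlgebra ℂ (Fin d))
    (fun j => WordModule (t j)) k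
  refine ⟨p, fun j => ?_⟩
  split_ifs with h <;> refine Matrix.toLin'.injective (LinearMap.ext fun v => ?_)
  · simpa [WordModule.smul_def] using (hp j).1 h (WordModule.of _ v)
  · simpa [WordModule.smul_def] using (hp j).2 h (WordModule.of _ v)

/-- Two finite families whose members realize each class of an equivalence relation equally often
are matched by a bijection. -/
theorem exists_equiv_of_card_eq {α β : Type*} [Finite α] [Finite β] (s : Setoid (α ⊕ β))
    (h : ∀ k, Nat.card {a // s (.inl a) k} = Nat.card {b // s (.inr b) k}) :
    ∃ σ : α ≃ β, ∀ a, s (.inl a) (.inr (σ a)) := by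
  let f : α → Quotient s := fun a => ⟦.inl a⟧
  let g : β → Quotient s := fun b => ⟦.inr b⟧
  have e : ∀ q, Nonempty ({a // f a = q} ≃ {b // g b = q}) := fun q => by
    induction q using Quotient.inductionOn with
    | h k =>
      simpa only [f, g, Quotient.eq] using Finite.card_eq.1 (h k)
  let σ : α ≃ β := (Equiv.sigmaFiberEquiv f).symm.trans
    ((Equiv.sigmaCongrRight fun q => (e q).some).trans (Equiv.sigmaFiberEquiv g))
  exact ⟨σ, fun a => Quotient.exact ((e (f a)).some ⟨a, rfl⟩).2.symm⟩

/-- The one-dimensional module on which all letters act as zero. -/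
theorem isSimpleModule_zero :
    IsSimpleModule (FreeAlgebra ℂ (Fin d)) (WordModule (0 : MPVTensor d 1)) :=
  WordModule.isSimpleModule one_pos fun W _ => by
    have : IsSimpleModule ℂ (Fin 1 → ℂ) := isSimpleModule_iff_finrank_eq_one.2 (by simp)
    exact eq_bot_or_eq_top W

open Classical in
/-- Semisimple tensors without zero blocks, with equal traces on polynomials without constant term,
have the same blocks up to order and isomorphism. The constant term is the action on the
one-dimensional zero module, which is one more simple module to be separated from the blocks. -/
theorem exists_equiv_of_trace_eq {r r' : ℕ} {m : Fin r → ℕ} {n : Fin r' → ℕ}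
    (S : ∀ k, MPVTensor d (m k)) (T : ∀ l, MPVTensor d (n l))
    [hS : ∀ k, IsSimpleModule (FreeAlgebra ℂ (Fin d)) (WordModule (S k))]
    [hT : ∀ l, IsSimpleModule (FreeAlgebra ℂ (Fin d)) (WordModule (T l))]
    (hS0 : ∀ k, S k ≠ 0) (hT0 : ∀ l, T l ≠ 0)
    (h : ∀ p, wordEval (0 : MPVTensor d 1) p = 0 →
      ∑ k, (wordEval (S k) p).trace = ∑ l, (wordEval (T l) p).trace) :
    ∃ σ : Fin r ≃ Fin r', ∀ k, Nonempty
      (WordModule (S k) ≃ₗ[FreeAlgebra ℂ (Fin d)] WordModule (T (σ k))) := by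
  let t : ∀ j : Option (Fin r ⊕ Fin r'), Σ D, MPVTensor d D
    | none => ⟨1, 0⟩
    | some (.inl k) => ⟨m k, S k⟩
    | some (.inr l) => ⟨n l, T l⟩
  have ht : ∀ j, IsSimpleModule (FreeAlgebra ℂ (Fin d)) (WordModule (t j).2) := by
    rintro (_ | k | l)
    exacts [isSimpleModule_zero, hS k, hT l]
  have ht0 : ∀ j, (t (some j)).2 ≠ 0 := by
    rintro (k | l)
    exacts [hS0 k, hT0 l]
  let s : Setoid (Fin r ⊕ Fin r') :=
    { r := fun j k => Nonempty
        (WordModule (t (some j)).2 ≃ₗ[FreeAlgebra ℂ (Fin d)] WordModule (t (some k)).2)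
      iseqv := ⟨fun _ => ⟨.refl _ _⟩, fun ⟨e⟩ => ⟨e.symm⟩, fun ⟨e⟩ ⟨e'⟩ => ⟨e.trans e'⟩⟩ }
  obtain ⟨σ, hσ⟩ := exists_equiv_of_card_eq s fun k => by
    obtain ⟨p, hp⟩ := exists_wordEval_eq_ite (fun j => (t j).1) (fun j => (t j).2) (some k)
    have hne : ¬ Nonempty (WordModule (0 : MPVTensor d 1) ≃ₗ[FreeAlgebra ℂ (Fin d)]
        WordModule (t (some k)).2) := by
      rintro ⟨e⟩
      obtain ⟨Y, Z, -, hZY, hi⟩ := WordModule.exists_intertwiner e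
      refine ht0 k (funext fun i => ?_)
      have : 0 = Y * (t (some k)).2 i := by simpa using hi i
      rw [← one_mul ((t (some k)).2 i), ← hZY, Matrix.mul_assoc, ← this, Matrix.mul_zero]
      rfl
    have h0 : wordEval (0 : MPVTensor d 1) p = 0 := (hp none).trans (if_neg hne)
    have htr : ∀ j, (wordEval (t (some j)).2 p).trace =
        if s j k then ((t (some k)).1 : ℂ) else 0 := fun j => by
      rw [hp (some j)]
      by_cases hj : s j k
      · rw [if_pos hj, if_pos (show Nonempty _ from hj), Matrix.trace_one, Fintype.card_fin]
        obtain ⟨e⟩ := hj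
        rw [WordModule.dim_eq e]
      · rw [if_neg hj, if_neg (show ¬ Nonempty _ from hj), Matrix.trace_zero]
    have hsum := h p h0
    have e1 : ∑ a, (wordEval (S a) p).trace =
        Nat.card {a // s (.inl a) k} * ((t (some k)).1 : ℂ) := by
      rw [Finset.sum_congr rfl fun a _ => htr (.inl a), ← Finset.sum_filter, Finset.sum_const,
        nsmul_eq_mul, Nat.card_eq_fintype_card, Fintype.card_subtype]
    have e2 : ∑ a, (wordEval (T a) p).trace =
        Nat.card {b // s (.inr b) k} * ((t (some k)).1 : ℂ) := by
      rw [Finset.sum_congr rfl fun a _ => htr (.inr a), ← Finset.sum_filter, Finset.sum_const,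
        nsmul_eq_mul, Nat.card_eq_fintype_card, Fintype.card_subtype]
    rw [e1, e2] at hsum
    have hD : ((t (some k)).1 : ℂ) ≠ 0 := by
      intro hz
      refine ht0 k (funext fun i => Matrix.ext fun a => ?_)
      rw [Nat.cast_eq_zero] at hz
      exact (hz ▸ a : Fin 0).elim0
    exact_mod_cast mul_right_cancel₀ hD hsum
  exact ⟨σ, hσ⟩

/-! ### Normal tensors -/

namespace IsNormalTensor

variable {D D' : ℕ} {A : MPVTensor d D} {B : MPVTensor d D'}

theorem dim_pos (hA : IsNormalTensor A) : 0 < D := by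
  rcases Nat.eq_zero_or_pos D with rfl | h
  · have := hA.simple
    rw [Module.finrank_zero_of_subsingleton] at this
    omega
  · exact h

theorem ne_zero (hA : IsNormalTensor A) : A ≠ 0 := by
  rintro rfl
  obtain ⟨ρ, hρ, h⟩ := hA.right_eigenvector
  have : Nonempty (Fin D) := ⟨⟨0, hA.dim_pos⟩⟩
  have h0 : ρ = 0 := by rw [← h]; simp [transferMap]
  exact hρ.isUnit.ne_zero h0

/-- The eigenvalue `1` of the transfer operator is nondegenerate. -/
theorem exists_smul_of_transferMap_eq (hA : IsNormalTensor A) {ρ X : Matrix (Fin D) (Fin D) ℂ}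
    (hρ : transferMap A ρ = ρ) (hρ0 : ρ ≠ 0) (hX : transferMap A X = X) : ∃ c : ℂ, X = c • ρ := by
  obtain ⟨c, hc⟩ := (finrank_eq_one_iff_of_nonzero'
    (⟨ρ, Module.End.mem_eigenspace_iff.2 (by simpa using hρ)⟩ :
      Module.End.eigenspace (transferMap A) 1) (by simpa using hρ0)).1 hA.simple
    ⟨X, Module.End.mem_eigenspace_iff.2 (by simpa using hX)⟩
  exact ⟨c, (congrArg Subtype.val hc).symm⟩

/-- A normal tensor has no proper invariant subspace `W`. The transfer operator `E` maps the space
of matrices with range in `W` to itself, and the left fixed point `σ` makes `E - 1` on it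
non-surjective; so `E` has a fixed point with range in `W`, a multiple of the full-rank `ρ`. -/
theorem eq_bot_or_eq_top (hA : IsNormalTensor A) (W : Submodule ℂ (Fin D → ℂ))
    (hW : ∀ i, ∀ v ∈ W, A i *ᵥ v ∈ W) : W = ⊥ ∨ W = ⊤ := by
  refine or_iff_not_imp_left.2 fun hbot => ?_
  obtain ⟨w, hw, hw0⟩ := (Submodule.ne_bot_iff W).1 hbot
  obtain ⟨ρ, hρ, hEρ⟩ := hA.right_eigenvector
  obtain ⟨σ, hσ, hEσ⟩ := hA.left_eigenvector
  have : Nonempty (Fin D) := ⟨⟨0, hA.dim_pos⟩⟩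
  let 𝒮 : Submodule ℂ (Matrix (Fin D) (Fin D) ℂ) :=
    { carrier := {X | ∀ v, X *ᵥ v ∈ W}
      add_mem' := fun hX hY v => by rw [Matrix.add_mulVec]; exact W.add_mem (hX v) (hY v)
      zero_mem' := fun v => by rw [Matrix.zero_mulVec]; exact W.zero_mem
      smul_mem' := fun c X hX v => by rw [Matrix.smul_mulVec]; exact W.smul_mem c (hX v) }
  have hE : ∀ X ∈ 𝒮, (transferMap A - 1) X ∈ 𝒮 := fun X hX => by
    refine 𝒮.sub_mem (fun v => ?_) hX
    change (∑ i, A i * X * (A i)ᴴ) *ᵥ v ∈ W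
    rw [Matrix.sum_mulVec]
    refine W.sum_mem fun i _ => ?_
    rw [Matrix.mul_assoc, ← Matrix.mulVec_mulVec, ← Matrix.mulVec_mulVec]
    exact hW i _ (hX _)
  let g : 𝒮 →ₗ[ℂ] 𝒮 := (transferMap A - 1).restrict hE
  have hsurj : ¬ Function.Surjective g := fun hs => by
    obtain ⟨X, hX⟩ := hs ⟨Matrix.vecMulVec w (star w), fun v => by
      rw [Matrix.vecMulVec_mulVec, op_smul_eq_smul]
      exact W.smul_mem _ hw⟩
    have h1 : transferMap A X - X = Matrix.vecMulVec w (star w) := congrArg Subtype.val hX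
    have h2 : (σ * Matrix.vecMulVec w (star w)).trace = 0 := by
      rw [← h1, Matrix.mul_sub, Matrix.trace_sub, hEσ, sub_self]
    rw [Matrix.mul_vecMulVec, Matrix.trace_vecMulVec, dotProduct_comm] at h2
    exact (hσ.dotProduct_mulVec_pos hw0).ne' h2
  have hinj : ¬ Function.Injective g := fun h => hsurj (LinearMap.injective_iff_surjective.1 h)
  rw [← LinearMap.ker_eq_bot, ← ne_eq, Submodule.ne_bot_iff] at hinj
  obtain ⟨X, hX, hX0⟩ := hinj
  have hfix : transferMap A X = X := sub_eq_zero.1 (congrArg Subtype.val hX)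
  obtain ⟨c, hc⟩ := hA.exists_smul_of_transferMap_eq hEρ hρ.isUnit.ne_zero hfix
  have hc0 : c ≠ 0 := by
    rintro rfl
    exact hX0 (Subtype.ext (by simpa using hc))
  refine Submodule.eq_top_iff'.2 fun v => ?_
  have hv := X.2 (c⁻¹ • (ρ⁻¹ *ᵥ v))
  rwa [hc, Matrix.smul_mulVec, Matrix.mulVec_smul, Matrix.mulVec_mulVec,
    Matrix.mul_nonsing_inv _ ((Matrix.isUnit_iff_isUnit_det _).1 hρ.isUnit), Matrix.one_mulVec,
    smul_smul, mul_inv_cancel₀ hc0, one_smul] at hv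

theorem isSimpleModule_smul (hA : IsNormalTensor A) {c : ℂ} (hc : c ≠ 0) :
    IsSimpleModule (FreeAlgebra ℂ (Fin d)) (WordModule (c • A)) :=
  WordModule.isSimpleModule hA.dim_pos fun W hW => hA.eq_bot_or_eq_top W fun i v hv => by
    have := W.smul_mem c⁻¹ (hW i v hv)
    rwa [Pi.smul_apply, Matrix.smul_mulVec, smul_smul, inv_mul_cancel₀ hc, one_smul] at this

/-- If `Y` intertwines `μ A` and `ν B`, then `Y Yᴴ` is an eigenvector of the transfer operator of
`A` for the eigenvalue `(ν / μ) ^ 2`. -/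
theorem transferMap_mul_conjTranspose {μ ν : ℝ} (hμ : 0 < μ) (hB1 : transferMap B 1 = 1)
    {Y : Matrix (Fin D) (Fin D') ℂ} (h : ∀ i, ((μ : ℂ) • A) i * Y = Y * ((ν : ℂ) • B) i) :
    transferMap A (Y * Yᴴ) = (((ν / μ) ^ 2 : ℝ) : ℂ) • (Y * Yᴴ) := by
  have hAY : ∀ i, A i * Y = ((ν / μ : ℝ) : ℂ) • (Y * B i) := fun i => by
    have h' := h i
    rw [Pi.smul_apply, Pi.smul_apply, Matrix.smul_mul, Matrix.mul_smul] at h'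
    have hμ' : (μ : ℂ) ≠ 0 := by exact_mod_cast hμ.ne'
    rw [← one_smul ℂ (A i * Y), ← inv_mul_cancel₀ hμ', ← smul_smul, h', smul_smul,
      Complex.ofReal_div, div_eq_inv_mul]
  have hB1' : ∑ i, B i * (B i)ᴴ = 1 := by simpa [transferMap] using hB1
  calc transferMap A (Y * Yᴴ) = ∑ i, (A i * Y) * (A i * Y)ᴴ := by
        simp [transferMap, Matrix.mul_assoc]
    _ = ∑ i, (((ν / μ) ^ 2 : ℝ) : ℂ) • (Y * (B i * (B i)ᴴ) * Yᴴ) := by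
        refine Finset.sum_congr rfl fun i _ => ?_
        rw [hAY, Matrix.conjTranspose_smul, Matrix.smul_mul, Matrix.mul_smul, smul_smul,
          Matrix.conjTranspose_mul]
        simp only [Complex.star_def, Complex.conj_ofReal, ← pow_two, Complex.ofReal_pow,
          Matrix.mul_assoc]
    _ = _ := by
        rw [← Finset.smul_sum, ← Matrix.sum_mul, ← Matrix.mul_sum, hB1', Matrix.mul_one]

theorem weight_le_of_intertwiner (hA : IsNormalTensor A) {μ ν : ℝ} (hμ : 0 < μ)
    (hB1 : transferMap B 1 = 1) {Y : Matrix (Fin D) (Fin D') ℂ} (hY : Y * Yᴴ ≠ 0)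
    (h : ∀ i, ((μ : ℂ) • A) i * Y = Y * ((ν : ℂ) • B) i) : ν ≤ μ := by
  have hev : (transferMap A).HasEigenvalue (((ν / μ) ^ 2 : ℝ) : ℂ) :=
    Module.End.hasEigenvalue_of_hasEigenvector
      ⟨Module.End.mem_eigenspace_iff.2 (transferMap_mul_conjTranspose hμ hB1 h), hY⟩
  by_contra! hlt
  have h1 : 1 < (ν / μ) ^ 2 := one_lt_pow₀ ((one_lt_div hμ).2 hlt) two_ne_zero
  have := hA.norm_lt_one _ hev (by exact_mod_cast h1.ne')
  rw [Complex.norm_real, Real.norm_of_nonneg (sq_nonneg _)] at this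
  exact this.not_gt h1

/-- In the unital gauge, an invertible intertwiner of weighted normal tensors can be rescaled to a
unitary one: `1` and `Y Yᴴ` are fixed points of the same transfer operator. -/
theorem exists_unitary_intertwiner (hA : IsNormalTensor A) (hB : IsNormalTensor B) {μ ν : ℝ}
    (hμ : 0 < μ) (hν : 0 < ν) (hA1 : transferMap A 1 = 1) (hB1 : transferMap B 1 = 1)
    {Y : Matrix (Fin D) (Fin D') ℂ} {Z : Matrix (Fin D') (Fin D) ℂ} (hYZ : Y * Z = 1)
    (hZY : Z * Y = 1) (h : ∀ i, ((μ : ℂ) • A) i * Y = Y * ((ν : ℂ) • B) i) :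
    ∃ V : Matrix (Fin D) (Fin D') ℂ, V * Vᴴ = 1 ∧ Vᴴ * V = 1 ∧
      ∀ i, ((μ : ℂ) • A) i * V = V * ((ν : ℂ) • B) i := by
  have : Nonempty (Fin D) := ⟨⟨0, hA.dim_pos⟩⟩
  have : Nonempty (Fin D') := ⟨⟨0, hB.dim_pos⟩⟩
  have hne : ∀ {m n : ℕ} [Nonempty (Fin m)] {P : Matrix (Fin m) (Fin n) ℂ}
      {Q : Matrix (Fin n) (Fin m) ℂ}, P * Q = 1 → P * Pᴴ ≠ 0 := fun {m n _ P Q} hPQ h0 => by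
    rw [Matrix.self_mul_conjTranspose_eq_zero] at h0
    rw [h0, Matrix.zero_mul] at hPQ
    exact zero_ne_one hPQ
  have hZ : ∀ i, ((ν : ℂ) • B) i * Z = Z * ((μ : ℂ) • A) i := fun i => by
    rw [← Matrix.one_mul (((ν : ℂ) • B) i), ← hZY, Matrix.mul_assoc Z, ← h, ← Matrix.mul_assoc,
      Matrix.mul_assoc, hYZ, Matrix.mul_one]
  have hμν : μ = ν := le_antisymm (hB.weight_le_of_intertwiner hν hA1 (hne hZY) hZ)
    (hA.weight_le_of_intertwiner hμ hB1 (hne hYZ) h)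
  have hfix : transferMap A (Y * Yᴴ) = Y * Yᴴ := by
    rw [transferMap_mul_conjTranspose hμ hB1 h, hμν, div_self hν.ne']
    simp
  obtain ⟨c, hc⟩ := hA.exists_smul_of_transferMap_eq hA1 one_ne_zero hfix
  have hc0 : c ≠ 0 := by
    rintro rfl
    exact hne hYZ (by simpa using hc)
  have hc_nonneg : 0 ≤ c := by
    have := (Matrix.posSemidef_self_mul_conjTranspose Y).diag_nonneg (i := ⟨0, hA.dim_pos⟩)
    simpa [hc] using this
  obtain ⟨x, hx0, rfl⟩ : ∃ x : ℝ, 0 < x ∧ (x : ℂ) = c := by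
    refine ⟨c.re, ?_, (Complex.eq_re_of_ofReal_le hc_nonneg).symm⟩
    have := (lt_of_le_of_ne hc_nonneg hc0.symm)
    exact (Complex.lt_def.1 this).1
  have hYY : Yᴴ * Y = (x : ℂ) • 1 := by
    rw [← Matrix.one_mul Yᴴ, ← hZY, Matrix.mul_assoc Z, hc]
    simp [hZY]
  have hs : star (((√x)⁻¹ : ℝ) : ℂ) * (((√x)⁻¹ : ℝ) : ℂ) * (x : ℂ) = 1 := by
    rw [Complex.star_def, Complex.conj_ofReal, ← Complex.ofReal_mul, ← Complex.ofReal_mul,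
      ← mul_inv, Real.mul_self_sqrt hx0.le, inv_mul_cancel₀ hx0.ne', Complex.ofReal_one]
  refine ⟨(((√x)⁻¹ : ℝ) : ℂ) • Y, ?_, ?_, fun i => ?_⟩
  · rw [Matrix.conjTranspose_smul, Matrix.smul_mul, Matrix.mul_smul, smul_smul, hc, smul_smul,
      mul_comm (((√x)⁻¹ : ℝ) : ℂ), hs, one_smul]
  · rw [Matrix.conjTranspose_smul, Matrix.smul_mul, Matrix.mul_smul, smul_smul, hYY, smul_smul,
      hs, one_smul]
  · rw [Matrix.mul_smul, Matrix.smul_mul, h i]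

end IsNormalTensor

/-! ### Canonical forms -/

theorem span_range_prod_map_ι :
    Submodule.span ℂ (Set.range fun l : List (Fin d) => (l.map (FreeAlgebra.ι ℂ)).prod) = ⊤ := by
  have h := congrArg Subalgebra.toSubmodule (FreeAlgebra.adjoin_range_ι ℂ (Fin d))
  rw [Algebra.adjoin_eq_span, Algebra.top_toSubmodule] at h
  refine top_le_iff.1 (h ▸ Submodule.span_mono fun p hp => ?_)
  obtain ⟨L, hL, rfl⟩ := Submonoid.exists_list_of_mem_closure hp
  obtain ⟨l, rfl⟩ : L ∈ Set.range (List.map (FreeAlgebra.ι ℂ)) := by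
    rwa [Set.range_list_map, Set.mem_ofPred_eq]
  exact ⟨l, rfl⟩

/-- The matrix product vectors determine the traces of all polynomials without constant term. -/
theorem trace_wordEval_eq_of_mpv_eq {D D' : ℕ} {A : MPVTensor d D} {B : MPVTensor d D'}
    (hAB : ∀ N : ℕ, 1 ≤ N → mpv A N = mpv B N) {p : FreeAlgebra ℂ (Fin d)}
    (hp : wordEval (0 : MPVTensor d 1) p = 0) :
    (wordEval A p).trace = (wordEval B p).trace := by
  -- The difference of the traces is `D - D'` times the constant term.
  suffices h : (wordEval A p).trace - (wordEval B p).trace =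
      ((D : ℂ) - D') * (wordEval (0 : MPVTensor d 1) p).trace by
    rwa [hp, Matrix.trace_zero, mul_zero, sub_eq_zero] at h
  clear hp
  have hmem : p ∈ Submodule.span ℂ
      (Set.range fun l : List (Fin d) => (l.map (FreeAlgebra.ι ℂ)).prod) :=
    span_range_prod_map_ι ▸ Submodule.mem_top
  induction hmem using Submodule.span_induction with
  | zero => simp
  | add x y _ _ hx hy =>
    simp only [map_add, Matrix.trace_add]
    linear_combination hx + hy
  | smul c x _ hx =>
    simp only [map_smul, Matrix.trace_smul, smul_eq_mul]
    linear_combination c * hx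
  | mem x hx =>
    obtain ⟨l, rfl⟩ := hx
    have hw : ∀ {m : ℕ} (C : MPVTensor d m),
        wordEval C (l.map (FreeAlgebra.ι ℂ)).prod = (l.map C).prod := fun C => by
      simp [map_list_prod, Function.comp_def]
    rw [hw, hw, hw]
    rcases l with _ | ⟨i, l⟩
    · simp
    · have h := congrFun (hAB (i :: l).length (by simp)) (i :: l).get
      have hm : ∀ {m : ℕ} (C : MPVTensor d m),
          mpv C (i :: l).length (i :: l).get = ((i :: l).map C).prod.trace := fun C => by
        rw [mpv, ← Function.comp_def C, ← List.map_ofFn, List.ofFn_get]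
      rw [hm, hm] at h
      rw [h, sub_self, List.map_cons, List.prod_cons, Pi.zero_apply, Matrix.zero_mul,
        Matrix.trace_zero, mul_zero]

namespace CanonicalForm

variable {D D' : ℕ} {A : MPVTensor d D} {B : MPVTensor d D'}

/-- The summands of a canonical form, with their weights. -/
def summand (c : CanonicalForm A) (k : Fin c.r) : MPVTensor d (c.dim k) :=
  (c.μ k : ℂ) • c.block k

theorem isSimpleModule_summand (c : CanonicalForm A) (k : Fin c.r) :
    IsSimpleModule (FreeAlgebra ℂ (Fin d)) (WordModule (c.summand k)) :=
  (c.normal k).isSimpleModule_smul (by exact_mod_cast (c.μ_pos k).ne')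

theorem summand_ne_zero (c : CanonicalForm A) (k : Fin c.r) : c.summand k ≠ 0 :=
  smul_ne_zero (by exact_mod_cast (c.μ_pos k).ne') (c.normal k).ne_zero

theorem wordEval_eq (c : CanonicalForm A) (p : FreeAlgebra ℂ (Fin d)) :
    wordEval A p = c.U * Matrix.blockDiagonal' (fun k => wordEval (c.summand k) p) * c.Uᴴ := by
  induction p using FreeAlgebra.induction with
  | grade0 z =>
    have h : (fun k => wordEval (c.summand k) (algebraMap ℂ _ z)) = z • 1 := funext fun k => by
      rw [AlgHom.commutes, Algebra.algebraMap_eq_smul_one]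
      rfl
    rw [h, AlgHom.commutes, Algebra.algebraMap_eq_smul_one, Matrix.blockDiagonal'_smul,
      Matrix.blockDiagonal'_one, Matrix.mul_smul, Matrix.smul_mul, Matrix.mul_one,
      c.U_mul_conjTranspose]
  | grade1 i =>
    simp only [wordEval_ι]
    exact c.eq_directSum i
  | mul a b ha hb =>
    simp only [map_mul]
    rw [Matrix.blockDiagonal'_mul, ha, hb]
    simp only [Matrix.mul_assoc]
    rw [← Matrix.mul_assoc c.Uᴴ c.U, c.conjTranspose_mul_U, Matrix.one_mul]
  | add a b ha hb =>
    have h : (fun k => wordEval (c.summand k) (a + b)) =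
        (fun k => wordEval (c.summand k) a) + fun k => wordEval (c.summand k) b :=
      funext fun k => map_add _ a b
    rw [h, map_add, Matrix.blockDiagonal'_add, Matrix.mul_add, Matrix.add_mul, ha, hb]

theorem trace_wordEval (c : CanonicalForm A) (p : FreeAlgebra ℂ (Fin d)) :
    (wordEval A p).trace = ∑ k, (wordEval (c.summand k) p).trace := by
  rw [c.wordEval_eq, Matrix.trace_mul_comm, ← Matrix.mul_assoc, c.conjTranspose_mul_U,
    Matrix.one_mul, Matrix.trace_blockDiagonal']

/-- Tensors with equal matrix product vectors have the same summands up to order and gauge. -/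
theorem exists_equiv_intertwiner (cA : CanonicalForm A) (cB : CanonicalForm B)
    (hAB : ∀ N : ℕ, 1 ≤ N → mpv A N = mpv B N) :
    ∃ σ : Fin cA.r ≃ Fin cB.r, ∀ k, ∃ (Y : Matrix (Fin (cA.dim k)) (Fin (cB.dim (σ k))) ℂ)
      (Z : Matrix (Fin (cB.dim (σ k))) (Fin (cA.dim k)) ℂ), Y * Z = 1 ∧ Z * Y = 1 ∧
      ∀ i, cA.summand k i * Y = Y * cB.summand (σ k) i := by
  have := cA.isSimpleModule_summand
  have := cB.isSimpleModule_summand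
  obtain ⟨σ, hσ⟩ := exists_equiv_of_trace_eq cA.summand cB.summand cA.summand_ne_zero
    cB.summand_ne_zero fun p hp => by
      rw [← cA.trace_wordEval, ← cB.trace_wordEval, trace_wordEval_eq_of_mpv_eq hAB hp]
  exact ⟨σ, fun k => WordModule.exists_intertwiner (hσ k).some⟩

/-- Intertwiners between the summands assemble to one between the tensors; it is unitary if they
are. -/
theorem exists_intertwiner_of_summand (cA : CanonicalForm A) (cB : CanonicalForm B)
    (σ : Fin cA.r ≃ Fin cB.r) (Y : ∀ k, Matrix (Fin (cA.dim k)) (Fin (cB.dim (σ k))) ℂ)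
    (Z : ∀ k, Matrix (Fin (cB.dim (σ k))) (Fin (cA.dim k)) ℂ)
    (hYZ : ∀ k, Y k * Z k = 1) (hZY : ∀ k, Z k * Y k = 1)
    (h : ∀ k i, cA.summand k i * Y k = Y k * cB.summand (σ k) i) :
    ∃ (X : Matrix (Fin D) (Fin D') ℂ) (X' : Matrix (Fin D') (Fin D) ℂ),
      X * X' = 1 ∧ X' * X = 1 ∧ (∀ i, A i * X = X * B i) ∧ ((∀ k, Z k = (Y k)ᴴ) → X' = Xᴴ) := by
  let e : (Σ k, Fin (cB.dim (σ k))) ≃ Σ l, Fin (cB.dim l) :=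
    σ.sigmaCongrLeft (β := fun l => Fin (cB.dim l))
  -- The basis adapted to the summands of `B`, in the order of the summands of `A`.
  let V : Matrix (Fin D') (Σ k, Fin (cB.dim (σ k))) ℂ := cB.U.submatrix id e
  have hVV : V * Vᴴ = 1 := by
    rw [← cB.U_mul_conjTranspose, Matrix.conjTranspose_submatrix, Matrix.submatrix_mul_equiv,
      Matrix.submatrix_id_id]
  have hVV' : Vᴴ * V = 1 := by
    have : (cB.Uᴴ * cB.U).submatrix e e = 1 := by
      rw [cB.conjTranspose_mul_U, Matrix.submatrix_one_equiv]
    rw [← this]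
    rfl
  have hB : ∀ i, B i = V * Matrix.blockDiagonal' (fun k => cB.summand (σ k) i) * Vᴴ := fun i => by
    have hbd : Matrix.blockDiagonal' (fun k => cB.summand (σ k) i) =
        (Matrix.blockDiagonal' (fun l => cB.summand l i)).submatrix e e := by
      ext ⟨k, a⟩ ⟨k', b⟩
      by_cases hk : k = k'
      · subst hk
        simp [e, Equiv.sigmaCongrLeft]
      · simp [e, Equiv.sigmaCongrLeft, Matrix.blockDiagonal'_apply_ne, hk]
    rw [hbd, Matrix.conjTranspose_submatrix, Matrix.submatrix_mul_equiv,
      Matrix.submatrix_mul_equiv, Matrix.submatrix_id_id]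
    exact cB.eq_directSum i
  have hA : ∀ i, A i = cA.U * Matrix.blockDiagonal' (fun k => cA.summand k i) * cA.Uᴴ :=
    cA.eq_directSum
  refine ⟨cA.U * Matrix.blockDiagonal' Y * Vᴴ, V * Matrix.blockDiagonal' Z * cA.Uᴴ,
    ?_, ?_, fun i => ?_, fun hZ => ?_⟩
  · calc _ = cA.U * (Matrix.blockDiagonal' Y * (Vᴴ * V) * Matrix.blockDiagonal' Z) * cA.Uᴴ := by
          simp only [Matrix.mul_assoc]
      _ = 1 := by
          rw [hVV', Matrix.mul_one, ← Matrix.blockDiagonal'_mul, funext hYZ,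
            ← Pi.one_def, Matrix.blockDiagonal'_one, Matrix.mul_one, cA.U_mul_conjTranspose]
  · calc _ = V * (Matrix.blockDiagonal' Z * (cA.Uᴴ * cA.U) * Matrix.blockDiagonal' Y) * Vᴴ := by
          simp only [Matrix.mul_assoc]
      _ = 1 := by
          rw [cA.conjTranspose_mul_U, Matrix.mul_one, ← Matrix.blockDiagonal'_mul, funext hZY,
            ← Pi.one_def, Matrix.blockDiagonal'_one, Matrix.mul_one, hVV]
  · calc _ = cA.U * (Matrix.blockDiagonal' (fun k => cA.summand k i) * (cA.Uᴴ * cA.U) *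
          Matrix.blockDiagonal' Y) * Vᴴ := by rw [hA i]; simp only [Matrix.mul_assoc]
      _ = cA.U * (Matrix.blockDiagonal' Y * (Vᴴ * V) *
          Matrix.blockDiagonal' (fun k => cB.summand (σ k) i)) * Vᴴ := by
          rw [cA.conjTranspose_mul_U, hVV', Matrix.mul_one, Matrix.mul_one,
            ← Matrix.blockDiagonal'_mul, ← Matrix.blockDiagonal'_mul]
          simp only [h]
      _ = _ := by rw [hB i]; simp only [Matrix.mul_assoc]
  · rw [Matrix.conjTranspose_mul, Matrix.conjTranspose_mul, Matrix.conjTranspose_conjTranspose,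
      Matrix.blockDiagonal'_conjTranspose, ← funext hZ, Matrix.mul_assoc]

theorem exists_intertwiner (cA : CanonicalForm A) (cB : CanonicalForm B)
    (hAB : ∀ N : ℕ, 1 ≤ N → mpv A N = mpv B N) :
    ∃ (X : Matrix (Fin D) (Fin D') ℂ) (X' : Matrix (Fin D') (Fin D) ℂ),
      X * X' = 1 ∧ X' * X = 1 ∧ ∀ i, A i * X = X * B i := by
  obtain ⟨σ, hσ⟩ := exists_equiv_intertwiner cA cB hAB
  choose Y Z hYZ hZY h using hσ
  obtain ⟨X, X', h1, h2, h3, -⟩ := exists_intertwiner_of_summand cA cB σ Y Z hYZ hZY h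
  exact ⟨X, X', h1, h2, h3⟩

theorem exists_unitary_intertwiner (cA : CanonicalForm A) (cB : CanonicalForm B)
    (hA1 : ∀ k, transferMap (cA.block k) 1 = 1) (hB1 : ∀ k, transferMap (cB.block k) 1 = 1)
    (hAB : ∀ N : ℕ, 1 ≤ N → mpv A N = mpv B N) :
    ∃ X : Matrix (Fin D) (Fin D') ℂ, X * Xᴴ = 1 ∧ Xᴴ * X = 1 ∧ ∀ i, A i * X = X * B i := by
  obtain ⟨σ, hσ⟩ := exists_equiv_intertwiner cA cB hAB
  choose Y Z hYZ hZY h using hσ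
  choose V hV hV' hVi using fun k => (cA.normal k).exists_unitary_intertwiner (cB.normal (σ k))
    (cA.μ_pos k) (cB.μ_pos (σ k)) (hA1 k) (hB1 (σ k)) (hYZ k) (hZY k) (h k)
  obtain ⟨X, X', h1, h2, h3, h4⟩ := exists_intertwiner_of_summand cA cB σ V (fun k => (V k)ᴴ)
    hV hV' hVi
  obtain rfl := h4 fun _ => rfl
  exact ⟨X, h1, h2, h3⟩

end CanonicalForm

theorem corollary2 {d D D' : ℕ} (A : MPVTensor d D) (B : MPVTensor d D')
    (hA : IsCanonical A) (hB : IsCanonical B)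
    (hAB : ∀ N : ℕ, 1 ≤ N → mpv A N = mpv B N) :
    ∃ h : D = D',
      (∃ X : GL (Fin D) ℂ, ∀ i,
        A i = (X : Matrix (Fin D) (Fin D) ℂ) * (B i).submatrix (Fin.cast h) (Fin.cast h) *
          ((X⁻¹ : GL (Fin D) ℂ) : Matrix (Fin D) (Fin D) ℂ)) ∧
      (IsUnitalCanonical A → IsUnitalCanonical B →
        ∃ X : Matrix (Fin D) (Fin D) ℂ, X ∈ Matrix.unitaryGroup (Fin D) ℂ ∧ ∀ i,
          A i = X * (B i).submatrix (Fin.cast h) (Fin.cast h) * X⁻¹) := by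
  obtain ⟨cA⟩ := hA
  obtain ⟨cB⟩ := hB
  obtain ⟨X, X', hX, hX', hi⟩ := cA.exists_intertwiner cB hAB
  obtain rfl : D = D' := by simpa using Matrix.square_of_invertible X X' hX hX'
  refine ⟨rfl, ⟨⟨X, X', hX, hX'⟩, fun i => ?_⟩, ?_⟩
  · change A i = X * B i * X'
    rw [← hi, Matrix.mul_assoc, hX, Matrix.mul_one]
  · rintro ⟨uA, hA1⟩ ⟨uB, hB1⟩
    obtain ⟨V, hV, hV', hVi⟩ := uA.exists_unitary_intertwiner uB hA1 hB1 hAB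
    refine ⟨V, Matrix.mem_unitaryGroup_iff.2 hV, fun i => ?_⟩
    change A i = V * B i * V⁻¹
    rw [Matrix.inv_eq_right_inv hV, ← hVi, Matrix.mul_assoc, hV, Matrix.mul_one]

end
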